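/- Let $X$ be a compact Hausdorff space, let $\gamma=\{\gamma_1,\dots,\gamma_N\}$ be a finite family (repetitions allowed) of continuous maps $X\to X$ with graph $G=\{(x,y)\in X\times X : x=\gamma_k(y)\text{ for some }k\}$, and let $\mathbb X\subseteq X$. Assume: (I) $\mathbb X$ is dense in $X$ and completely invariant under $\gamma$, i.e. $\gamma_k(\mathbb X)\subseteq\mathbb X$ and $\gamma_k^{-1}(\mathbb X)\subseteq\mathbb X$ for all $k$; (II) the images $\gamma_1(\mathbb X),\dots,\gamma_N(\mathbb X)$ are pairwise disjoint; (III) each restriction $\gamma_k|_{\mathbb X}$ is injective; (IV) all $\gamma_k$ are embeddings. Let $M_{\mathbb X}$ be the C*-algebra of bounded operators on $\ell^2(\mathbb X)$, with standard basis $\{e_x\}_{x\in\mathbb X}$. For $n\in\mathbb Z$ let $\upsilon_n$ be the operator on $\ell^2(\mathbb Z)$ with $\upsilon_n e_k=e_{n+k}$, and let $C^*(\mathbb Z)$ be the C*-algebra generated by the $\upsilon_n$. The tensor product $M_{\mathbb X}\otimes C^*(\mathbb Z)$ acts on the Hilbert space $\ell^2(\mathbb X)\otimes\ell^2(\mathbb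 Z)$. Define $\rho_A(a)\in M_{\mathbb X}$ for $a\in C(X)$ and $\rho_E(f)\in M_{\mathbb X}$ for $f\in C(G)$ by $$\rho_A(a)e_x=a(x)\,e_x,\qquad \rho_E(f)e_y=\sum_{k=1}^N f(\gamma_k(y),y)\,e_{\gamma_k(y)}\qquad(x,y\in\mathbb X),$$ put $\hat\rho_A(a)=\rho_A(a)\otimes\upsilon_0$ and $\hat\rho_E(f)=\rho_E(f)\otimes\upsilon_1$, and let $C^*(\hat\rho)$ be the C*-subalgebra of $M_{\mathbb X}\otimes C^*(\mathbb Z)$ generated by $\hat\rho_A(C(X))\cup\hat\rho_E(C(G))$. For $m,n\in\mathbb N_0$ let $X_{m,n}$ be the space of all pairs $((x_m,\dots,x_0),(y_n,\dots,y_0))$ of finite sequences in $X$ such that $x_0=y_0$, each $(x_i,x_{i-1})$ lies in $G$, and each $(y_i,y_{i-1})$ lies in $G$. For an index sequence $\boldsymbol k=(k_n,\dots,k_1)$ in $\{1,\dots,N\}^n$ write $\gamma_{\boldsymbol k}=\gamma_{k_n}\circ\dots\circ\gamma_{k_1}$ and $\boldsymbol\gamma_{\boldsymbol k}(x)=(\gamma_{k_n,\dots,k_1}(x),\dots,\gamma_{k_1}(x),x)$.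 For $f\in C(X_{m,n})$ let $\rho_{m,n}(f)\in M_{\mathbb X}$ be the operator with $$\rho_{m,n}(f)e_y=\sum_{\boldsymbol j\in\{1,\dots,N\}^m} f(\boldsymbol\gamma_{\boldsymbol j}(x),\boldsymbol\gamma_{\boldsymbol k}(x))\,e_{\gamma_{\boldsymbol j}(x)}$$ if $y=\gamma_{\boldsymbol k}(x)$ for some (necessarily unique) $x\in\mathbb X$ and index sequence $\boldsymbol k$ of length $n$, and $\rho_{m,n}(f)e_y=0$ if $y\in\mathbb X$ is not of this form. Let $E_{m,n}$ be the range of $\rho_{m,n}$, and for $k\in\mathbb Z$ let $B_k\subseteq M_{\mathbb X}$ be the norm-closed linear span of all $E_{m,n}$ with $m-n=k$. Then $$C^*(\hat\rho)=\bigoplus_{k\in\mathbb Z}B_k\otimes\upsilon_k$$ as a closed direct sum: the subspaces $B_k\otimes\upsilon_k=\{b\otimes\upsilon_k: b\in B_k\}$ are norm closed, $C^*(\hat\rho)$ is the norm closure of their linear span, and each $B_k\otimes\upsilon_k$ meets the closed linear span of the $B_l\otimes\upsilon_l$, $l\neq k$, only in $0$. -/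

import Mathlib

open Topology

open scoped TensorProduct InnerProductSpace ENNReal lp

noncomputable section

namespace KajiwaraWatatani

/-! ### Squared matrices: bounded operators on `ℓ²` of a set -/

/-- The Hilbert space `ℓ²(ι)` of complex square-summable families. -/
abbrev Hil (ι : Type*) : Type _ := lp (fun _ : ι => ℂ) 2

/-- `ι`-squared matrices: bounded operators on `ℓ²(ι)`. -/
abbrev Mat (ι : Type*) : Type _ := Hil ι →L[ℂ] Hil ι

open Classical in
/-- The standard basis vector `e_x` of `ℓ²(ι)`. -/
def e {ι : Type*} (x : ι) : Hil ι := lp.single 2 x (1 : ℂ)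

theorem e_apply_self {ι : Type*} (x : ι) : (e x : Hil ι) x = 1 := by
  simp [e]

theorem e_apply_ne {ι : Type*} {x y : ι} (h : y ≠ x) : (e x : Hil ι) y = 0 := by
  classical
  unfold e
  rw [lp.single_apply, Pi.single_eq_of_ne h]

theorem inner_e_left {ι : Type*} (x : ι) (v : Hil ι) : inner ℂ (e x) v = v x := by
  classical
  unfold e
  convert lp.inner_single_left (𝕜 := ℂ) (G := fun _ : ι => ℂ) x (1 : ℂ) v using 2
  simp

/-- A squared matrix is determined by its columns. -/
theorem mat_ext {ι : Type*} {S T : Mat ι} (h : ∀ x, S (e x) = T (e x)) : S = T := by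
  classical
  refine lp.ext_continuousLinearMap (ENNReal.ofNat_ne_top (n := nat_lit 2)) fun i => ?_
  refine ContinuousLinearMap.ext_ring ?_
  have := h i
  unfold e at this
  rw [ContinuousLinearMap.comp_apply, ContinuousLinearMap.comp_apply]
  convert this using 2 <;> simp

theorem exists_diagonal {ι : Type*} (g : ι → ℂ) (C : ℝ) (hg : ∀ x, ‖g x‖ ≤ C) :
    ∃ T : Mat ι, ∀ x, T (e x) = g x • e x := by
  classical
  rcases isEmpty_or_nonempty ι with hι | ⟨⟨x₀⟩⟩
  · exact ⟨0, fun x => hι.elim x⟩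
  have hC : 0 ≤ C := (norm_nonneg _).trans (hg x₀)
  have key : ∀ (v : Hil ι) (x : ι), ‖g x * v x‖ ≤ ‖((C : ℂ) • v : Hil ι) x‖ := by
    intro v x
    simp only [lp.coeFn_smul, Pi.smul_apply, smul_eq_mul, norm_mul, Complex.norm_real,
      Real.norm_of_nonneg hC]
    exact mul_le_mul_of_nonneg_right (hg x) (norm_nonneg _)
  have hsum : ∀ v : Hil ι, Summable fun x => ‖v x‖ ^ (2 : ℝ≥0∞).toReal := fun v =>
    (memℓp_gen_iff (by norm_num)).1 (lp.memℓp v)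
  have hmem : ∀ v : Hil ι, Memℓp (fun x => g x * v x) 2 := by
    intro v
    refine memℓp_gen (Summable.of_nonneg_of_le (fun x => by positivity) (fun x => ?_)
      (hsum ((C : ℂ) • v)))
    exact Real.rpow_le_rpow (norm_nonneg _) (key v x) (by norm_num)
  let L : Hil ι →ₗ[ℂ] Hil ι :=
    { toFun := fun v => ⟨fun x => g x * v x, hmem v⟩
      map_add' := fun v w => by
        ext x
        exact mul_add (g x) (v x) (w x)
      map_smul' := fun c v => by
        ext x
        exact mul_left_comm (g x) c (v x) }
  have hL : ∀ v, ‖L v‖ ≤ C * ‖v‖ := by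
    intro v
    have h2 : ‖((C : ℂ) • v : Hil ι)‖ = C * ‖v‖ := by
      rw [norm_smul, Complex.norm_real, Real.norm_of_nonneg hC]
    rw [← h2]
    refine lp.norm_le_of_forall_sum_le (by norm_num) (norm_nonneg _) fun s => ?_
    refine (Finset.sum_le_sum fun x _ => Real.rpow_le_rpow (norm_nonneg _) (key v x)
      (by norm_num)).trans ?_
    exact lp.sum_rpow_le_norm_rpow (by norm_num) _ s
  refine ⟨L.mkContinuous C hL, fun x => ?_⟩
  ext y
  change g y * (e x : Hil ι) y = g x * (e x : Hil ι) y
  by_cases h : y = x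
  · rw [h]
  · rw [e_apply_ne h]
    simp

theorem exists_isometry {ι : Type*} (φ : ι → ι) (hφ : Function.Injective φ) :
    ∃ T : Mat ι, ∀ x, T (e x) = e (φ x) := by
  classical
  have ho : Orthonormal ℂ fun x => (e (φ x) : Hil ι) := by
    rw [orthonormal_iff_ite]
    intro x y
    rw [inner_e_left]
    by_cases h : x = y
    · simp [h, e_apply_self]
    · rw [e_apply_ne (fun h' => h (hφ h')), if_neg h]
  refine ⟨ho.orthogonalFamily.linearIsometry.toContinuousLinearMap, fun x => ?_⟩
  change ho.orthogonalFamily.linearIsometry (e x) = _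
  conv_lhs => unfold e
  have := OrthogonalFamily.linearIsometry_apply_single ho.orthogonalFamily (i := x) (1 : ℂ)
  refine Eq.trans ?_ (this.trans ?_)
  · congr
  · simp

theorem exists_weightedShift {ι : Type*} (φ ψ : ι → ι) (hφ : Function.Injective φ)
    (hψ : Function.Injective ψ) (g : ι → ℂ) (C : ℝ) (hg : ∀ x, ‖g x‖ ≤ C) :
    ∃ T : Mat ι, (∀ x, T (e (ψ x)) = g x • e (φ x)) ∧
      ∀ y, (∀ x, ψ x ≠ y) → T (e y) = 0 := by
  obtain ⟨D, hD⟩ := exists_diagonal g C hg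
  obtain ⟨V, hV⟩ := exists_isometry φ hφ
  obtain ⟨W, hW⟩ := exists_isometry ψ hψ
  have hadj : ∀ x y, (ContinuousLinearMap.adjoint W (e y) : Hil ι) x = (e y : Hil ι) (ψ x) := by
    intro x y
    rw [← inner_e_left, ContinuousLinearMap.adjoint_inner_right, hW, inner_e_left]
  refine ⟨V ∘L D ∘L ContinuousLinearMap.adjoint W, fun x => ?_, fun y hy => ?_⟩
  · have : ContinuousLinearMap.adjoint W (e (ψ x)) = e x := by
      ext z
      rw [hadj]
      by_cases h : z = x
      · rw [h, e_apply_self, e_apply_self]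
      · rw [e_apply_ne h, e_apply_ne (fun h' => h (hψ h'))]
    simp [this, hD, hV]
  · have : ContinuousLinearMap.adjoint W (e y) = 0 := by
      ext z
      rw [hadj, e_apply_ne (hy z)]
      rfl
    simp [this]

/-! ### The shifts and tensor products -/

theorem exists_shift (n : ℤ) : ∃! T : Mat ℤ, ∀ k : ℤ, T (e k) = e (n + k) := by
  obtain ⟨T, hT⟩ := exists_isometry (fun k : ℤ => n + k) (add_right_injective n)
  exact ⟨T, hT, fun S hS => mat_ext fun k => (hS k).trans (hT k).symm⟩

/-- The shift `υ n` on `ℓ²(ℤ)` with `υ n e_k = e_(n + k)`; the group C*-algebra `C*(ℤ)` is the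
C*-algebra of operators on `ℓ²(ℤ)` generated by these, and `υ n` is its element corresponding to
`n`. -/
def υ (n : ℤ) : Mat ℤ := (exists_shift n).choose

theorem υ_e (n k : ℤ) : υ n (e k) = e (n + k) := (exists_shift n).choose_spec.1 k

/-- The Hilbert space tensor product `ℓ²(ι) ⊗ ℓ²(ℤ)` (completion of the algebraic one). -/
def HilZ (ι : Type*) : Type _ := UniformSpace.Completion (Hil ι ⊗[ℂ] Hil ℤ)

instance (ι : Type*) : NormedAddCommGroup (HilZ ι) :=
  inferInstanceAs (NormedAddCommGroup (UniformSpace.Completion (Hil ι ⊗[ℂ] Hil ℤ)))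

instance (ι : Type*) : InnerProductSpace ℂ (HilZ ι) :=
  inferInstanceAs (InnerProductSpace ℂ (UniformSpace.Completion (Hil ι ⊗[ℂ] Hil ℤ)))

instance (ι : Type*) : CompleteSpace (HilZ ι) :=
  inferInstanceAs (CompleteSpace (UniformSpace.Completion (Hil ι ⊗[ℂ] Hil ℤ)))

/-- The canonical linear isometry of the algebraic tensor product into its completion. -/
def incl (ι : Type*) : Hil ι ⊗[ℂ] Hil ℤ →ₗᵢ[ℂ] HilZ ι :=
  UniformSpace.Completion.toComplₗᵢ (𝕜 := ℂ) (E := Hil ι ⊗[ℂ] Hil ℤ)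

theorem denseRange_incl (ι : Type*) : DenseRange (incl ι) :=
  UniformSpace.Completion.denseRange_coe (α := Hil ι ⊗[ℂ] Hil ℤ)

/-- Bounded operators on `ℓ²(ι) ⊗ ℓ²(ℤ)`. The (spatial) C*-algebra tensor product of the algebra
of `ι`-squared matrices with `C*(ℤ)` is, isometrically, the closed linear span in here of the
operators `α ⊗ β` with `α` an `ι`-squared matrix and `β ∈ C*(ℤ)`. -/
abbrev MatZ (ι : Type*) : Type _ := HilZ ι →L[ℂ] HilZ ι

/-- The operator `α ⊗ β` on `ℓ²(ι) ⊗ ℓ²(ℤ)`: the extension by continuity to the completed tensor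
product of the map `v ⊗ w ↦ α v ⊗ β w`. -/
def tensor {ι : Type*} (α : Mat ι) (β : Mat ℤ) : MatZ ι :=
  (TensorProduct.mapL α β).completion

theorem tensor_incl {ι : Type*} (α : Mat ι) (β : Mat ℤ) (z : Hil ι ⊗[ℂ] Hil ℤ) :
    tensor α β (incl ι z) = incl ι (TensorProduct.mapL α β z) :=
  ContinuousLinearMap.completion_apply_coe _ z

theorem tensor_tmul {ι : Type*} (α : Mat ι) (β : Mat ℤ) (v : Hil ι) (w : Hil ℤ) :
    tensor α β (incl ι (v ⊗ₜ[ℂ] w)) = incl ι (α v ⊗ₜ[ℂ] β w) := by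
  rw [tensor_incl, TensorProduct.mapL_tmul]

/-- Operators on `ℓ²(ι) ⊗ ℓ²(ℤ)` agreeing on the vectors `v ⊗ w` are equal. -/
theorem matZ_ext {ι : Type*} {S T : MatZ ι}
    (h : ∀ (v : Hil ι) (w : Hil ℤ), S (incl ι (v ⊗ₜ[ℂ] w)) = T (incl ι (v ⊗ₜ[ℂ] w))) :
    S = T := by
  refine ContinuousLinearMap.ext fun z => congrFun
    ((denseRange_incl ι).equalizer S.continuous T.continuous (funext fun z => ?_)) z
  induction z using TensorProduct.induction_on with
  | zero => simp
  | tmul v w => exact h v w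
  | add a b ha hb =>
    simp only [Function.comp_apply] at ha hb ⊢
    rw [map_add, map_add, map_add, ha, hb]

/-- The linear map `α ↦ α ⊗ β`. -/
def tensorLeft (ι : Type*) (β : Mat ℤ) : Mat ι →ₗ[ℂ] MatZ ι where
  toFun α := tensor α β
  map_add' α α' := matZ_ext fun v w => by
    rw [_root_.add_apply, tensor_tmul, tensor_tmul, tensor_tmul,
      _root_.add_apply, TensorProduct.add_tmul, map_add]
  map_smul' c α := matZ_ext fun v w => by
    rw [RingHom.id_apply, _root_.smul_apply, tensor_tmul, tensor_tmul,
      _root_.smul_apply, ← TensorProduct.smul_tmul', map_smul]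

/-! ### Iterated function systems, chains and bichains -/

section IFS

variable {X : Type*} [TopologicalSpace X] {N : ℕ}

/-- The graph `{(x, y) | x = γ_k(y) for some k}` of the system, a subspace of `X × X`. -/
abbrev Graph (γ : Fin N → C(X, X)) : Type _ := {p : X × X // ∃ k, p.1 = γ k p.2}

/-- The relation `x ≺ y`: `x = γ_k(y)` for some `k`. -/
def Prec (γ : Fin N → C(X, X)) (x y : X) : Prop := ∃ k, x = γ k y

/-- The space of chains `x_n ≺ ⋯ ≺ x_1 ≺ x_0` of length `n`; the entry `x_i` is `c.1 i`. -/
abbrev Chain (γ : Fin N → C(X, X)) (n : ℕ) : Type _ :=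
  {c : Fin (n + 1) → X // ∀ i : Fin n, Prec γ (c i.succ) (c i.castSucc)}

/-- The space of bichains of length `(m, n)`: pairs of a chain `x_m ≺ ⋯ ≺ x_0` and a chain
`y_n ≺ ⋯ ≺ y_0` with `x_0 = y_0`. -/
abbrev Bichain (γ : Fin N → C(X, X)) (m n : ℕ) : Type _ :=
  {p : Chain γ m × Chain γ n // p.1.1 0 = p.2.1 0}

/-- The chain `(γ_{k_n}(⋯γ_{k_1}(x)), …, γ_{k_1}(x), x)` of an index sequence `(k_n, …, k_1)`. -/
def orbit (γ : Fin N → C(X, X)) {n : ℕ} (k : Fin n → Fin N) (x : X) : Chain γ n :=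
  ⟨fun i => Fin.induction (motive := fun _ => X) x (fun j y => γ (k j) y) i,
    fun i => ⟨k i, by simp⟩⟩

theorem orbit_zero (γ : Fin N → C(X, X)) {n : ℕ} (k : Fin n → Fin N) (x : X) :
    (orbit γ k x).1 0 = x := rfl

theorem orbit_succ (γ : Fin N → C(X, X)) {n : ℕ} (k : Fin n → Fin N) (x : X) (i : Fin n) :
    (orbit γ k x).1 i.succ = γ (k i) ((orbit γ k x).1 i.castSucc) := by
  simp [orbit]

/-- The point `γ_{k_n}(⋯γ_{k_1}(x))`. -/
def word (γ : Fin N → C(X, X)) {n : ℕ} (k : Fin n → Fin N) (x : X) : X :=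
  (orbit γ k x).1 (Fin.last n)

/-- The bichain formed by the chains of two index sequences at the same point. -/
def biorbit (γ : Fin N → C(X, X)) {m n : ℕ} (j : Fin m → Fin N) (k : Fin n → Fin N) (x : X) :
    Bichain γ m n :=
  ⟨(orbit γ j x, orbit γ k x), rfl⟩

theorem continuous_orbit (γ : Fin N → C(X, X)) {n : ℕ} (k : Fin n → Fin N) :
    Continuous (orbit γ k) := by
  refine Continuous.subtype_mk (continuous_pi fun i => ?_) _
  induction i using Fin.induction with
  | zero => exact continuous_id
  | succ i ih =>
    simp only [Fin.induction_succ]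
    exact (γ (k i)).continuous.comp ih

theorem continuous_biorbit (γ : Fin N → C(X, X)) {m n : ℕ} (j : Fin m → Fin N)
    (k : Fin n → Fin N) : Continuous (biorbit γ j k) :=
  Continuous.subtype_mk ((continuous_orbit γ j).prodMk (continuous_orbit γ k)) _

/-- The conditions on a subset `S` of `X`: it is dense and completely invariant under `γ`, the
images `γ_k(S)` are pairwise disjoint, and each `γ_k` is injective on `S`. -/
structure Admissible (γ : Fin N → C(X, X)) (S : Set X) : Prop where
  dense : Dense S
  image_subset : ∀ k, γ k '' S ⊆ S
  preimage_subset : ∀ k, γ k ⁻¹' S ⊆ S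
  disjoint : ∀ j k, j ≠ k → Disjoint (γ j '' S) (γ k '' S)
  injOn : ∀ k, Set.InjOn (γ k) S

variable {γ : Fin N → C(X, X)} {S : Set X}

/-- The restriction of `γ_k` to `S`. -/
def Admissible.map (h : Admissible γ S) (k : Fin N) (x : S) : S :=
  ⟨γ k x, h.image_subset k ⟨x, x.2, rfl⟩⟩

theorem Admissible.map_inj (h : Admissible γ S) {j k : Fin N} {x y : S}
    (hxy : h.map j x = h.map k y) : j = k ∧ x = y := by
  have hv : γ j x = γ k y := congrArg Subtype.val hxy
  have hjk : j = k := by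
    by_contra hne
    exact Set.disjoint_left.1 (h.disjoint j k hne) ⟨x, x.2, rfl⟩ ⟨y, y.2, hv.symm⟩
  subst hjk
  exact ⟨rfl, Subtype.ext (h.injOn j x.2 y.2 hv)⟩

theorem Admissible.orbit_mem (h : Admissible γ S) {n : ℕ} (k : Fin n → Fin N) (x : S)
    (i : Fin (n + 1)) : (orbit γ k x).1 i ∈ S := by
  induction i using Fin.induction with
  | zero => exact x.2
  | succ i ih =>
    rw [orbit_succ]
    exact h.image_subset _ ⟨_, ih, rfl⟩

/-- The point `γ_{k_n}(⋯γ_{k_1}(x))` of `S`, for `x ∈ S`. -/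
def Admissible.word (h : Admissible γ S) {n : ℕ} (k : Fin n → Fin N) (x : S) : S :=
  ⟨KajiwaraWatatani.word γ k x, h.orbit_mem k x _⟩

theorem Admissible.word_inj (h : Admissible γ S) {n : ℕ} {k l : Fin n → Fin N} {x y : S}
    (hxy : h.word k x = h.word l y) : k = l ∧ x = y := by
  have hv : (orbit γ k x).1 (Fin.last n) = (orbit γ l y).1 (Fin.last n) :=
    congrArg Subtype.val hxy
  have step : ∀ i : Fin n, (orbit γ k x).1 i.succ = (orbit γ l y).1 i.succ →
      k i = l i ∧ (orbit γ k x).1 i.castSucc = (orbit γ l y).1 i.castSucc := by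
    intro i hi
    rw [orbit_succ, orbit_succ] at hi
    have := h.map_inj (j := k i) (k := l i) (x := ⟨_, h.orbit_mem k x i.castSucc⟩)
      (y := ⟨_, h.orbit_mem l y i.castSucc⟩) (Subtype.ext hi)
    exact ⟨this.1, congrArg Subtype.val this.2⟩
  have all : ∀ i : Fin (n + 1), (orbit γ k x).1 i = (orbit γ l y).1 i := by
    intro i
    induction i using Fin.reverseInduction with
    | last => exact hv
    | cast i ih => exact (step i ih).2
  exact ⟨funext fun i => (step i (all i.succ)).1, Subtype.ext (all 0)⟩

/-! ### The maps `ρ_A`, `ρ_E` and `ρ_{m,n}` -/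

variable [CompactSpace X]

theorem exists_bound (g : X → ℂ) (hg : Continuous g) : ∃ C : ℝ, ∀ x, ‖g x‖ ≤ C := by
  obtain ⟨C, hC⟩ := isCompact_univ.exists_bound_of_continuousOn (f := g) hg.continuousOn
  exact ⟨C, fun x => hC x (Set.mem_univ x)⟩

theorem exists_rhoA (S : Set X) (a : C(X, ℂ)) :
    ∃! T : Mat S, ∀ x : S, T (e x) = a x • e x := by
  obtain ⟨C, hC⟩ := exists_bound a a.continuous
  obtain ⟨T, hT⟩ := exists_diagonal (fun x : S => a x) C fun x => hC x
  exact ⟨T, hT, fun R hR => mat_ext fun x => (hR x).trans (hT x).symm⟩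

/-- `ρ_A(a) e_x = a(x) e_x`. -/
def rhoA (S : Set X) (a : C(X, ℂ)) : Mat S := (exists_rhoA S a).choose

theorem rhoA_e (S : Set X) (a : C(X, ℂ)) (x : S) : rhoA S a (e x) = a x • e x :=
  (exists_rhoA S a).choose_spec.1 x

theorem exists_rhoE (h : Admissible γ S) (f : C(Graph γ, ℂ)) :
    ∃! T : Mat S, ∀ y : S,
      T (e y) = ∑ k : Fin N, f ⟨(γ k y, (y : X)), k, rfl⟩ • e (h.map k y) := by
  have hk : ∀ k : Fin N, ∃ T : Mat S, ∀ y : S,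
      T (e y) = f ⟨(γ k y, (y : X)), k, rfl⟩ • e (h.map k y) := by
    intro k
    obtain ⟨C, hC⟩ := exists_bound (fun x : X => f ⟨(γ k x, x), k, rfl⟩)
      (f.continuous.comp (Continuous.subtype_mk
        ((γ k).continuous.prodMk continuous_id) _))
    obtain ⟨T, hT, -⟩ := exists_weightedShift (h.map k) id (fun x y hxy => (h.map_inj hxy).2)
      Function.injective_id (fun y : S => f ⟨(γ k y, (y : X)), k, rfl⟩) C fun y => hC y
    exact ⟨T, hT⟩
  choose T hT using hk
  have hsum : ∀ y : S, (∑ k, T k) (e y) =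
      ∑ k : Fin N, f ⟨(γ k y, (y : X)), k, rfl⟩ • e (h.map k y) := by
    intro y
    rw [_root_.sum_apply]
    exact Finset.sum_congr rfl fun k _ => hT k y
  exact ⟨∑ k, T k, hsum, fun R hR => mat_ext fun y => (hR y).trans (hsum y).symm⟩

/-- `ρ_E(f) e_y = ∑_k f(γ_k(y), y) e_{γ_k(y)}`. -/
def rhoE (h : Admissible γ S) (f : C(Graph γ, ℂ)) : Mat S := (exists_rhoE h f).choose

theorem rhoE_e (h : Admissible γ S) (f : C(Graph γ, ℂ)) (y : S) :
    rhoE h f (e y) = ∑ k : Fin N, f ⟨(γ k y, (y : X)), k, rfl⟩ • e (h.map k y) :=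
  (exists_rhoE h f).choose_spec.1 y

theorem exists_rho (h : Admissible γ S) {m n : ℕ} (f : C(Bichain γ m n, ℂ)) :
    ∃! T : Mat S,
      (∀ (k : Fin n → Fin N) (x : S), T (e (h.word k x)) =
        ∑ j : Fin m → Fin N, f (biorbit γ j k x) • e (h.word j x)) ∧
      ∀ y : S, (∀ (k : Fin n → Fin N) (x : S), h.word k x ≠ y) → T (e y) = 0 := by
  have hjk : ∀ (j : Fin m → Fin N) (k : Fin n → Fin N), ∃ T : Mat S,
      (∀ x : S, T (e (h.word k x)) = f (biorbit γ j k x) • e (h.word j x)) ∧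
      ∀ y, (∀ x, h.word k x ≠ y) → T (e y) = 0 := by
    intro j k
    obtain ⟨C, hC⟩ := exists_bound (fun x : X => f (biorbit γ j k x))
      (f.continuous.comp (continuous_biorbit γ j k))
    exact exists_weightedShift (h.word j) (h.word k) (fun x y hxy => (h.word_inj hxy).2)
      (fun x y hxy => (h.word_inj hxy).2) (fun x : S => f (biorbit γ j k x)) C fun x => hC x
  choose T hT hT0 using hjk
  have h1 : ∀ (k : Fin n → Fin N) (x : S), (∑ k, ∑ j, T j k) (e (h.word k x)) =
      ∑ j : Fin m → Fin N, f (biorbit γ j k x) • e (h.word j x) := by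
    intro k x
    rw [_root_.sum_apply, Finset.sum_eq_single k]
    · rw [_root_.sum_apply]
      exact Finset.sum_congr rfl fun j _ => hT j k x
    · intro l _ hl
      rw [_root_.sum_apply]
      exact Finset.sum_eq_zero fun j _ => hT0 j l _ fun z hz => hl (h.word_inj hz).1
    · intro hk
      exact absurd (Finset.mem_univ k) hk
  have h2 : ∀ y : S, (∀ (k : Fin n → Fin N) (x : S), h.word k x ≠ y) →
      (∑ k, ∑ j, T j k) (e y) = 0 := by
    intro y hy
    rw [_root_.sum_apply]
    refine Finset.sum_eq_zero fun k _ => ?_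
    rw [_root_.sum_apply]
    exact Finset.sum_eq_zero fun j _ => hT0 j k y (hy k)
  refine ⟨_, ⟨h1, h2⟩, fun R hR => mat_ext fun y => ?_⟩
  by_cases hy : ∃ (k : Fin n → Fin N) (x : S), h.word k x = y
  · obtain ⟨k, x, rfl⟩ := hy
    exact (hR.1 k x).trans (h1 k x).symm
  · push Not at hy
    exact (hR.2 y hy).trans (h2 y hy).symm

/-- The operator `ρ_{m,n}(f)`: `e_y ↦ ∑_j f(chain of j at x, chain of k at x) e_{γ_j(x)}` when
`y = γ_k(x)` with `x ∈ S` and `k` an index sequence of length `n` (`x` and `k` are then unique),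
and `e_y ↦ 0` when `y` is not of this form. -/
def rho (h : Admissible γ S) {m n : ℕ} (f : C(Bichain γ m n, ℂ)) : Mat S :=
  (exists_rho h f).choose

theorem rho_e_word (h : Admissible γ S) {m n : ℕ} (f : C(Bichain γ m n, ℂ))
    (k : Fin n → Fin N) (x : S) : rho h f (e (h.word k x)) =
      ∑ j : Fin m → Fin N, f (biorbit γ j k x) • e (h.word j x) :=
  (exists_rho h f).choose_spec.1.1 k x

theorem rho_e_of_ne (h : Admissible γ S) {m n : ℕ} (f : C(Bichain γ m n, ℂ)) (y : S)
    (hy : ∀ (k : Fin n → Fin N) (x : S), h.word k x ≠ y) : rho h f (e y) = 0 :=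
  (exists_rho h f).choose_spec.1.2 y hy

/-- `E_{m,n}`, the range of `ρ_{m,n}`. -/
def E (h : Admissible γ S) (m n : ℕ) : Set (Mat S) :=
  Set.range fun f : C(Bichain γ m n, ℂ) => rho h f

/-- `B_k`, the closed linear span of the `E_{m,n}` with `m - n = k`. -/
def B (h : Admissible γ S) (k : ℤ) : Submodule ℂ (Mat S) :=
  (Submodule.span ℂ (⋃ (m : ℕ) (n : ℕ) (_ : (m : ℤ) - (n : ℤ) = k), E h m n)).topologicalClosure

/-- `B_k ⊗ υ_k = {b ⊗ υ_k | b ∈ B_k}`. -/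
def BTensor (h : Admissible γ S) (k : ℤ) : Submodule ℂ (MatZ S) :=
  (B h k).map (tensorLeft S (υ k))

/-- `ρ̂_A(a) = ρ_A(a) ⊗ υ_0`. -/
def rhoHatA (S : Set X) (a : C(X, ℂ)) : MatZ S := tensor (rhoA S a) (υ 0)

/-- `ρ̂_E(f) = ρ_E(f) ⊗ υ_1`. -/
def rhoHatE (h : Admissible γ S) (f : C(Graph γ, ℂ)) : MatZ S := tensor (rhoE h f) (υ 1)

/-- `C*(ρ̂)`, the C*-algebra generated by `ρ̂_A(A) ∪ ρ̂_E(E)`: the norm closure of the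
`*`-algebra generated by it. -/
def CStarRhoHat (h : Admissible γ S) : NonUnitalStarSubalgebra ℂ (MatZ S) :=
  (NonUnitalStarAlgebra.adjoin ℂ
    (Set.range (rhoHatA S) ∪ Set.range (rhoHatE h))).topologicalClosure

end IFS

/-- The set `C` is the closed direct sum of the subspaces `V i` of a normed space: these are
closed, `C` is the closure of their sum, and the sum is direct, even topologically: each `V i` meets
the closed span of the others only in `0`. -/
structure IsClosedDirectSum {F ι : Type*} [NormedAddCommGroup F] [NormedSpace ℂ F]
    (C : Set F) (V : ι → Submodule ℂ F) : Prop where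
  isClosed : ∀ i, IsClosed (V i : Set F)
  eq_closure : C = closure ((⨆ i, V i : Submodule ℂ F) : Set F)
  disjoint : ∀ i, Disjoint (V i) (⨆ (l : ι) (_ : l ≠ i), V l).topologicalClosure

end KajiwaraWatatani

end

/-!
The C*-algebra `C*(ρ̂)` is graded by the second tensor factor, and the theorem identifies its graded
pieces. There are three independent points.

*The pieces are closed and independent.* Since `υ_k` is unitary, `α ↦ α ⊗ υ_k` is bounded below,
so it maps the closed subspace `B_k` onto a closed subspace (`isClosed_map_tensorLeft_υ`). The
matrix coefficients of an operator at the vectors `v' ⊗ e_k` and `v ⊗ e_0` see the `k`-th piece only,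
which separates it from the closed span of the others (`disjoint_map_tensorLeft_υ`).

*`C*(ρ̂)` lies in the closure of the sum.* Explicit formulas on basis vectors give
`ρ_A(a) E_{m,n} ⊆ E_{m,n}`, `ρ_E(f) E_{m,n} ⊆ E_{m+1,n}`, `ρ_E(f)* E_{m+1,n} ⊆ E_{m,n}` and
`ρ_E(f)* E_{0,n} ⊆ E_{0,n+1}`. Thus the generators and their adjoints multiply the sum of the
`B_k ⊗ υ_k` into itself from the left. The operators with this property form a `*`-algebra
(`leftMultipliers`), and the sum contains `1`, so it contains the `*`-algebra generated by `ρ̂_A` and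
`ρ̂_E` (`adjoin_le_iSup_BTensor`).

*The sum lies in `C*(ρ̂)`.* The functions `f` on the space of bichains with
`ρ_{m,n}(f) ⊗ υ_{m-n} ∈ C*(ρ̂)` form a closed subspace. A bichain is determined by its top (or bottom)
entry and the bichain left after deleting it, so by the Stone–Weierstrass theorem the products of a
function of the former and a function of the latter have dense span. By the formulas above `ρ_{m,n}`
turns these products into products with `ρ_E(f)` or `ρ_E(f)*`, and induction, on `n` for `m = 0` and
then on `m`, shows that the subspace is everything (`rhoHatPreimage_eq_top`).
-/

noncomputable section

namespace KajiwaraWatatani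

/-! ### Elementary tensors of operators -/

theorem tensor_mul {ι : Type*} (α α' : Mat ι) (β β' : Mat ℤ) :
    tensor α β * tensor α' β' = tensor (α * α') (β * β') :=
  matZ_ext fun v w => by
    simp only [mul_apply_eq_comp, tensor_tmul]

theorem tensorLeft_apply {ι : Type*} (α : Mat ι) (β : Mat ℤ) :
    tensorLeft ι β α = tensor α β := rfl

theorem tensor_one (ι : Type*) : tensor (1 : Mat ι) 1 = 1 :=
  matZ_ext fun v w => by simp [tensor_tmul]

theorem inner_incl_tmul {ι : Type*} (v v' : Hil ι) (w w' : Hil ℤ) :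
    inner ℂ (incl ι (v ⊗ₜ[ℂ] w)) (incl ι (v' ⊗ₜ[ℂ] w')) = inner ℂ v v' * inner ℂ w w' := by
  rw [LinearIsometry.inner_map_map, TensorProduct.inner_tmul]

/-- A vector of `ℓ²(ι) ⊗ ℓ²(ℤ)` is determined by its inner products with elementary tensors. -/
theorem hilZ_ext {ι : Type*} {x y : HilZ ι}
    (h : ∀ (v : Hil ι) (w : Hil ℤ),
      inner ℂ (incl ι (v ⊗ₜ[ℂ] w)) x = inner ℂ (incl ι (v ⊗ₜ[ℂ] w)) y) : x = y := by
  have hx : Continuous fun z : HilZ ι => (inner ℂ z x : ℂ) := continuous_id.inner continuous_const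
  have hy : Continuous fun z : HilZ ι => (inner ℂ z y : ℂ) := continuous_id.inner continuous_const
  refine ext_inner_left ℂ fun z => congrFun
    (DenseRange.equalizer (denseRange_incl ι) hx hy (funext fun z => ?_)) z
  induction z using TensorProduct.induction_on with
  | zero => simp
  | tmul v w => exact h v w
  | add a b ha hb =>
    simp only [Function.comp_apply] at ha hb ⊢
    rw [map_add, inner_add_left, inner_add_left, ha, hb]

theorem star_tensor {ι : Type*} (α : Mat ι) (β : Mat ℤ) :
    star (tensor α β) = tensor (star α) (star β) :=
  matZ_ext fun v w => hilZ_ext fun v' w' => by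
    simp only [ContinuousLinearMap.star_eq_adjoint]
    rw [ContinuousLinearMap.adjoint_inner_right, tensor_tmul, tensor_tmul, inner_incl_tmul,
      inner_incl_tmul, ContinuousLinearMap.adjoint_inner_right,
      ContinuousLinearMap.adjoint_inner_right]

theorem norm_le_norm_tensor {ι : Type*} (α : Mat ι) {β : Mat ℤ} (hβ : ∀ w, ‖β w‖ = ‖w‖) :
    ‖α‖ ≤ ‖tensor α β‖ := by
  refine α.opNorm_le_bound (norm_nonneg _) fun v => ?_
  have he : ‖(e (0 : ℤ) : Hil ℤ)‖ = 1 := by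
    rw [@norm_eq_sqrt_re_inner ℂ, inner_e_left, e_apply_self]
    simp
  have := (tensor α β).le_opNorm (incl ι (v ⊗ₜ[ℂ] e 0))
  rwa [tensor_tmul, LinearIsometry.norm_map, LinearIsometry.norm_map, TensorProduct.norm_tmul,
    TensorProduct.norm_tmul, hβ, he, mul_one, mul_one] at this

/-- By the closed graph theorem, `α v ⊗ β w` being continuous in `α`. -/
theorem continuous_tensorLeft (ι : Type*) (β : Mat ℤ) : Continuous (tensorLeft ι β) := by
  refine (tensorLeft ι β).continuous_of_seq_closed_graph fun u α T hu hT => ?_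
  refine matZ_ext fun v w => ?_
  have h1 := (ContinuousLinearMap.apply ℂ (HilZ ι) (incl ι (v ⊗ₜ[ℂ] w))).continuous.tendsto T
  have h2 : Filter.Tendsto (fun n => incl ι (u n v ⊗ₜ[ℂ] β w)) Filter.atTop
      (𝓝 (incl ι (α v ⊗ₜ[ℂ] β w))) := by
    have h3 : Continuous fun a : Mat ι => incl ι (a v ⊗ₜ[ℂ] β w) :=
      (incl ι).continuous.comp (TensorProduct.continuous_tmul.comp
        ((ContinuousLinearMap.apply ℂ (Hil ι) v).continuous.prodMk continuous_const))
    exact (h3.tendsto α).comp hu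
  refine tendsto_nhds_unique (h1.comp hT) ?_
  change Filter.Tendsto _ _ (𝓝 (tensor α β _))
  rw [tensor_tmul]
  refine h2.congr fun n => ?_
  exact (tensor_tmul (u n) β v w).symm

/-! ### The shifts -/

theorem υ_zero : υ 0 = 1 := mat_ext fun k => by
  rw [υ_e, zero_add, one_apply_eq_self]

theorem υ_mul (m n : ℤ) : υ m * υ n = υ (m + n) := mat_ext fun k => by
  rw [mul_apply_eq_comp, υ_e, υ_e, υ_e, add_assoc]

theorem star_υ (n : ℤ) : star (υ n) = υ (-n) := mat_ext fun k => by
  ext l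
  rw [← inner_e_left, ContinuousLinearMap.star_eq_adjoint,
    ContinuousLinearMap.adjoint_inner_right, υ_e, υ_e, inner_e_left]
  by_cases hl : l = -n + k
  · rw [hl, add_neg_cancel_left, e_apply_self, e_apply_self]
  · rw [e_apply_ne hl, e_apply_ne fun h => hl (by omega)]

theorem norm_υ_apply (n : ℤ) (w : Hil ℤ) : ‖υ n w‖ = ‖w‖ := by
  refine ContinuousLinearMap.norm_map_iff_adjoint_comp_self (υ n) |>.2 ?_ w
  change star (υ n) * υ n = 1
  rw [star_υ, υ_mul, neg_add_cancel, υ_zero]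

theorem inner_υ_e (k l : ℤ) : inner ℂ (e k) (υ l (e 0)) = if l = k then (1 : ℂ) else 0 := by
  rw [υ_e, add_zero, inner_e_left]
  split_ifs with h
  · rw [h, e_apply_self]
  · exact e_apply_ne (Ne.symm h)

theorem isClosed_map_tensorLeft_υ {ι : Type*} (n : ℤ) (V : Submodule ℂ (Mat ι))
    (hV : IsClosed (V : Set (Mat ι))) :
    IsClosed (V.map (tensorLeft ι (υ n)) : Set (MatZ ι)) := by
  let L : Mat ι →L[ℂ] MatZ ι := ⟨tensorLeft ι (υ n), continuous_tensorLeft ι (υ n)⟩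
  have hL : AntilipschitzWith 1 L := L.antilipschitz_of_bound fun α => by
    rw [NNReal.coe_one, one_mul]
    exact norm_le_norm_tensor α (norm_υ_apply n)
  exact (hL.isClosedEmbedding L.uniformContinuous).isClosedMap _ hV

/-- Graded pieces `V_k ⊗ υ_k` are topologically independent: the matrix coefficients at
`(v' ⊗ e_k, v ⊗ e_0)` are continuous, vanish on `V_l ⊗ υ_l` for `l ≠ k`, and determine an operator
of the form `α ⊗ υ_k`. -/
theorem disjoint_map_tensorLeft_υ {ι : Type*} (V : ℤ → Submodule ℂ (Mat ι)) (k : ℤ) :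
    Disjoint ((V k).map (tensorLeft ι (υ k)))
      (⨆ (l : ℤ) (_ : l ≠ k), (V l).map (tensorLeft ι (υ l))).topologicalClosure := by
  have coeff : ∀ (α : Mat ι) (l : ℤ) (v v' : Hil ι),
      inner ℂ (incl ι (v' ⊗ₜ[ℂ] e k)) (tensor α (υ l) (incl ι (v ⊗ₜ[ℂ] e 0))) =
        inner ℂ v' (α v) * if l = k then 1 else 0 := fun α l v v' => by
    rw [tensor_tmul, inner_incl_tmul, inner_υ_e]
  rw [Submodule.disjoint_def]
  rintro _ ⟨α, -, rfl⟩ hα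
  have key : ∀ v v' : Hil ι, inner ℂ v' (α v) = 0 := by
    intro v v'
    let φ : MatZ ι →L[ℂ] ℂ := (innerSL ℂ (incl ι (v' ⊗ₜ[ℂ] e k))).comp
      (ContinuousLinearMap.apply ℂ (HilZ ι) (incl ι (v ⊗ₜ[ℂ] e 0)))
    have hle : (⨆ (l : ℤ) (_ : l ≠ k), (V l).map (tensorLeft ι (υ l))).topologicalClosure ≤
        φ.ker := by
      refine Submodule.topologicalClosure_minimal _ (iSup₂_le fun l hl => ?_) φ.isClosed_ker
      rintro _ ⟨a, -, rfl⟩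
      refine (coeff a l v v').trans ?_
      rw [if_neg hl, mul_zero]
    have h0 : φ (tensor α (υ k)) = 0 := hle hα
    have h1 : φ (tensor α (υ k)) = _ := coeff α k v v'
    rw [h0, if_pos rfl, mul_one] at h1
    exact h1.symm
  have : α = 0 := ContinuousLinearMap.ext fun v => ext_inner_left ℂ fun v' => by
    rw [key, _root_.zero_apply, inner_zero_right]
  rw [this, map_zero]

/-! ### Density of products, and multipliers of a subspace -/

theorem exists_continuousMap_apply_ne {W : Type*} [TopologicalSpace W] [T35Space W] {x y : W}
    (hxy : x ≠ y) : ∃ a : C(W, ℂ), a x ≠ a y := by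
  obtain ⟨f, hf, hne⟩ := separatesPoints_continuous_of_t35Space hxy
  exact ⟨⟨fun w => (f w : ℂ), Complex.continuous_ofReal.comp hf⟩,
    fun h' => hne (Complex.ofReal_injective h')⟩

/-- A form of the Stone–Weierstrass theorem: if two maps `φ`, `ψ` out of a compact space jointly
separate its points, the products `(a ∘ φ) (b ∘ ψ)` have dense linear span. -/
theorem eq_top_of_comp_mul_comp_mem {K Y Z : Type*} [TopologicalSpace K] [CompactSpace K]
    [TopologicalSpace Y] [T35Space Y] [TopologicalSpace Z] [T35Space Z]
    (φ : C(K, Y)) (ψ : C(K, Z)) (hinj : ∀ p q, φ p = φ q → ψ p = ψ q → p = q)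
    (D : Submodule ℂ C(K, ℂ)) (hD : IsClosed (D : Set C(K, ℂ)))
    (hmem : ∀ (a : C(Y, ℂ)) (b : C(Z, ℂ)), a.comp φ * b.comp ψ ∈ D) : D = ⊤ := by
  set s : Set C(K, ℂ) := Set.range fun p : C(Y, ℂ) × C(Z, ℂ) => p.1.comp φ * p.2.comp ψ
  have hsD : Submodule.span ℂ s ≤ D := Submodule.span_le.2 (by rintro _ ⟨p, rfl⟩; exact hmem _ _)
  have hone : (1 : C(K, ℂ)) ∈ Submodule.span ℂ s :=
    Submodule.subset_span ⟨(1, 1), by ext; simp⟩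
  have hmul : ∀ a ∈ Submodule.span ℂ s, ∀ b ∈ Submodule.span ℂ s, a * b ∈ Submodule.span ℂ s := by
    intro a ha b hb
    have := Submodule.mul_mem_mul ha hb
    rw [Submodule.span_mul_span] at this
    refine Submodule.span_mono ?_ this
    rintro _ ⟨_, ⟨p, rfl⟩, _, ⟨q, rfl⟩, rfl⟩
    refine ⟨(p.1 * q.1, p.2 * q.2), ?_⟩
    ext
    simp [mul_mul_mul_comm]
  have hstar : ∀ a ∈ Submodule.span ℂ s, star a ∈ Submodule.span ℂ s := by
    intro a ha
    induction ha using Submodule.span_induction with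
    | mem a ha =>
      obtain ⟨p, rfl⟩ := ha
      refine Submodule.subset_span ⟨(star p.1, star p.2), ?_⟩
      ext
      simp
    | zero => simp
    | add a b _ _ ha hb => rw [star_add]; exact add_mem ha hb
    | smul c a _ ha => rw [star_smul]; exact Submodule.smul_mem _ _ ha
  let A : StarSubalgebra ℂ C(K, ℂ) :=
    { carrier := Submodule.span ℂ s
      mul_mem' := fun ha hb => hmul _ ha _ hb
      add_mem' := fun ha hb => add_mem ha hb
      algebraMap_mem' := fun c => by
        rw [Algebra.algebraMap_eq_smul_one]
        exact Submodule.smul_mem _ _ hone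
      star_mem' := fun ha => hstar _ ha }
  have hA : A.SeparatesPoints := by
    intro p q hpq
    by_cases hφ : φ p = φ q
    · have hψ : ψ p ≠ ψ q := fun h' => hpq (hinj p q hφ h')
      obtain ⟨b, hb⟩ := exists_continuousMap_apply_ne hψ
      exact ⟨_, ⟨_, Submodule.subset_span ⟨(1, b), rfl⟩, rfl⟩, by simpa using hb⟩
    · obtain ⟨a, ha⟩ := exists_continuousMap_apply_ne hφ
      exact ⟨_, ⟨_, Submodule.subset_span ⟨(a, 1), rfl⟩, rfl⟩, by simpa using ha⟩
  have htop := ContinuousMap.starSubalgebra_topologicalClosure_eq_top_of_separatesPoints A hA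
  refine top_le_iff.1 fun f _ => ?_
  have hf : f ∈ A.topologicalClosure := htop ▸ StarSubalgebra.mem_top
  exact closure_minimal (s := (A : Set C(K, ℂ))) hsD hD hf

/-- The star subalgebra of all `T` such that `T` and its adjoint multiply the subspace `V` into
itself from the left. -/
def leftMultipliers {A : Type*} [Ring A] [StarRing A] [Algebra ℂ A] [StarModule ℂ A]
    (V : Submodule ℂ A) : NonUnitalStarSubalgebra ℂ A where
  carrier := {T | (∀ v ∈ V, T * v ∈ V) ∧ ∀ v ∈ V, star T * v ∈ V}
  add_mem' hS hT := ⟨fun v hv => by rw [add_mul]; exact add_mem (hS.1 v hv) (hT.1 v hv),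
    fun v hv => by rw [star_add, add_mul]; exact add_mem (hS.2 v hv) (hT.2 v hv)⟩
  zero_mem' := ⟨fun v _ => by simp, fun v _ => by simp⟩
  mul_mem' hS hT := ⟨fun v hv => by rw [mul_assoc]; exact hS.1 _ (hT.1 v hv),
    fun v hv => by rw [star_mul, mul_assoc]; exact hT.2 _ (hS.2 v hv)⟩
  smul_mem' c T hT := ⟨fun v hv => by rw [smul_mul_assoc]; exact V.smul_mem c (hT.1 v hv),
    fun v hv => by rw [star_smul, smul_mul_assoc]; exact V.smul_mem _ (hT.2 v hv)⟩
  star_mem' hT := ⟨hT.2, fun v hv => by rw [star_star]; exact hT.1 v hv⟩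

/-! ### Chains and bichains -/

section IFS

variable {X : Type*} [TopologicalSpace X] {N : ℕ} (γ : Fin N → C(X, X))

theorem orbit_snoc_castSucc {n : ℕ} (k : Fin n → Fin N) (i : Fin N) (x : X) (l : Fin (n + 1)) :
    (orbit γ (Fin.snoc k i : Fin (n + 1) → Fin N) x).1 l.castSucc = (orbit γ k x).1 l := by
  induction l using Fin.induction with
  | zero => rfl
  | succ l ih => rw [← Fin.succ_castSucc, orbit_succ, orbit_succ, ih, Fin.snoc_castSucc]

theorem orbit_snoc_last {n : ℕ} (k : Fin n → Fin N) (i : Fin N) (x : X) :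
    (orbit γ (Fin.snoc k i : Fin (n + 1) → Fin N) x).1 (Fin.last (n + 1)) =
      γ i (word γ k x) := by
  rw [← Fin.succ_last, orbit_succ, orbit_snoc_castSucc, Fin.snoc_last, word]

theorem orbit_cons_succ {n : ℕ} (i : Fin N) (k : Fin n → Fin N) (x : X) (l : Fin (n + 1)) :
    (orbit γ (Fin.cons i k : Fin (n + 1) → Fin N) x).1 l.succ = (orbit γ k (γ i x)).1 l := by
  induction l using Fin.induction with
  | zero =>
    rw [orbit_succ, Fin.cons_zero]
    rfl
  | succ l ih => rw [orbit_succ, orbit_succ, Fin.cons_succ, ← Fin.succ_castSucc, ih]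

theorem continuous_chain_apply {n : ℕ} (i : Fin (n + 1)) :
    Continuous fun c : Chain γ n => c.1 i :=
  (continuous_apply i).comp continuous_subtype_val

theorem continuous_bichain_fst {m n : ℕ} (i : Fin (m + 1)) :
    Continuous fun p : Bichain γ m n => p.1.1.1 i :=
  (continuous_chain_apply γ i).comp (continuous_fst.comp continuous_subtype_val)

theorem continuous_bichain_snd {m n : ℕ} (i : Fin (n + 1)) :
    Continuous fun p : Bichain γ m n => p.1.2.1 i :=
  (continuous_chain_apply γ i).comp (continuous_snd.comp continuous_subtype_val)

/-- Deletion of the top entry `x_{n+1}` of a chain. -/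
def chainInit (n : ℕ) : C(Chain γ (n + 1), Chain γ n) where
  toFun c := ⟨fun i => c.1 i.castSucc, fun i => c.2 i.castSucc⟩
  continuous_toFun := Continuous.subtype_mk
    (continuous_pi fun i : Fin (n + 1) => continuous_chain_apply γ i.castSucc) _

/-- Deletion of the bottom entry `x_0` of a chain. -/
def chainTail (n : ℕ) : C(Chain γ (n + 1), Chain γ n) where
  toFun c := ⟨fun i => c.1 i.succ, fun i => c.2 i.succ⟩
  continuous_toFun := Continuous.subtype_mk
    (continuous_pi fun i : Fin (n + 1) => continuous_chain_apply γ i.succ) _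

/-- Extension of a chain with top entry `x_n` by the entry `γ_i(x_n)`. -/
def chainSnoc (n : ℕ) (i : Fin N) : C(Chain γ n, Chain γ (n + 1)) where
  toFun c := ⟨(Fin.snoc c.1 (γ i (c.1 (Fin.last n))) : Fin (n + 2) → X), fun l => by
    induction l using Fin.lastCases with
    | last => exact ⟨i, by rw [Fin.succ_last, Fin.snoc_last, Fin.snoc_castSucc]⟩
    | cast l =>
      rw [Fin.succ_castSucc, Fin.snoc_castSucc, Fin.snoc_castSucc]
      exact c.2 l⟩
  continuous_toFun := Continuous.subtype_mk (Continuous.finSnoc (A := fun _ => X)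
    continuous_subtype_val ((γ i).continuous.comp (continuous_chain_apply γ (Fin.last n)))) _

/-- The chain of length `0` with the given entry. -/
def chainPoint : C(X, Chain γ 0) where
  toFun x := ⟨fun _ => x, fun i => i.elim0⟩
  continuous_toFun := (continuous_pi fun _ => continuous_id).subtype_mk _

theorem chainInit_orbit {n : ℕ} (k : Fin n → Fin N) (i : Fin N) (x : X) :
    chainInit γ n (orbit γ (Fin.snoc k i : Fin (n + 1) → Fin N) x) = orbit γ k x :=
  Subtype.ext (funext fun l => orbit_snoc_castSucc γ k i x l)

theorem chainTail_orbit {n : ℕ} (i : Fin N) (k : Fin n → Fin N) (x : X) :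
    chainTail γ n (orbit γ (Fin.cons i k : Fin (n + 1) → Fin N) x) = orbit γ k (γ i x) :=
  Subtype.ext (funext fun l => orbit_cons_succ γ i k x l)

theorem chainSnoc_orbit {n : ℕ} (k : Fin n → Fin N) (i : Fin N) (x : X) :
    chainSnoc γ n i (orbit γ k x) = orbit γ (Fin.snoc k i : Fin (n + 1) → Fin N) x := by
  refine Subtype.ext (funext fun l => ?_)
  induction l using Fin.lastCases with
  | last =>
    rw [orbit_snoc_last]
    exact Fin.snoc_last (α := fun _ => X) _ _
  | cast l =>
    rw [orbit_snoc_castSucc]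
    exact Fin.snoc_castSucc (α := fun _ => X) _ _ _

/-- Deletion of the entry `x_{m+1}` of a bichain of length `(m + 1, n)`. -/
def bichainInit (m n : ℕ) : C(Bichain γ (m + 1) n, Bichain γ m n) where
  toFun p := ⟨(chainInit γ m p.1.1, p.1.2), p.2⟩
  continuous_toFun := by fun_prop

/-- Extension of the first chain of a bichain, with top entry `x_m`, by the entry `γ_i(x_m)`. -/
def bichainSnoc (m n : ℕ) (i : Fin N) : C(Bichain γ m n, Bichain γ (m + 1) n) where
  toFun p := ⟨(chainSnoc γ m i p.1.1, p.1.2), by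
    rw [← p.2]
    exact Fin.snoc_castSucc (α := fun _ => X) (γ i (p.1.1.1 (Fin.last m))) p.1.1.1 0⟩
  continuous_toFun := by fun_prop

/-- The bichain `((y_1), (y_{n+1}, …, y_1))` obtained from `((y_0), (y_{n+1}, …, y_0))`. -/
def bichainTail (n : ℕ) : C(Bichain γ 0 (n + 1), Bichain γ 0 n) where
  toFun p := ⟨(chainPoint γ (p.1.2.1 1), chainTail γ n p.1.2), rfl⟩
  continuous_toFun := (((chainPoint γ).continuous.comp (continuous_bichain_snd γ 1)).prodMk
    ((chainTail γ n).continuous.comp (continuous_snd.comp continuous_subtype_val))).subtype_mk _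

/-- The edge `(x_{m+1}, x_m)` at the top of the first chain of a bichain. -/
def topEdge (m n : ℕ) : C(Bichain γ (m + 1) n, Graph γ) where
  toFun p := ⟨(p.1.1.1 (Fin.last (m + 1)), p.1.1.1 (Fin.last m).castSucc), p.1.1.2 (Fin.last m)⟩
  continuous_toFun := ((continuous_bichain_fst γ _).prodMk (continuous_bichain_fst γ _)).subtype_mk _

/-- The edge `(y_1, y_0)` at the bottom of the second chain of a bichain. -/
def bottomEdge (m n : ℕ) : C(Bichain γ m (n + 1), Graph γ) where
  toFun p := ⟨(p.1.2.1 1, p.1.2.1 0), p.1.2.2 0⟩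
  continuous_toFun := ((continuous_bichain_snd γ _).prodMk (continuous_bichain_snd γ _)).subtype_mk _

/-- The edge `(γ_i(x_m), x_m)` over the top entry of the first chain of a bichain. -/
def nextEdge (m n : ℕ) (i : Fin N) : C(Bichain γ m n, Graph γ) where
  toFun p := ⟨(γ i (p.1.1.1 (Fin.last m)), p.1.1.1 (Fin.last m)), i, rfl⟩
  continuous_toFun := (((γ i).continuous.comp (continuous_bichain_fst γ _)).prodMk
    (continuous_bichain_fst γ _)).subtype_mk _

instance compactSpace_chain [CompactSpace X] [T2Space X] (n : ℕ) : CompactSpace (Chain γ n) := by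
  have hset : {c : Fin (n + 1) → X | ∀ i : Fin n, Prec γ (c i.succ) (c i.castSucc)} =
      ⋂ i : Fin n, ⋃ k, {c | c i.succ = γ k (c i.castSucc)} := by
    ext c
    simp [Prec]
  refine isCompact_iff_compactSpace.1
    (IsClosed.isCompact
      (s := {c : Fin (n + 1) → X | ∀ i : Fin n, Prec γ (c i.succ) (c i.castSucc)}) ?_)
  rw [hset]
  exact isClosed_iInter fun i => isClosed_iUnion_of_finite fun k =>
    isClosed_eq (by fun_prop) (by fun_prop)

instance compactSpace_bichain [CompactSpace X] [T2Space X] (m n : ℕ) :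
    CompactSpace (Bichain γ m n) :=
  isCompact_iff_compactSpace.1 (isClosed_eq ((continuous_chain_apply γ 0).comp continuous_fst)
    ((continuous_chain_apply γ 0).comp continuous_snd)).isCompact

theorem bichain_eq_of_init_eq {m n : ℕ} {p q : Bichain γ (m + 1) n}
    (htop : p.1.1.1 (Fin.last (m + 1)) = q.1.1.1 (Fin.last (m + 1)))
    (hinit : bichainInit γ m n p = bichainInit γ m n q) : p = q := by
  refine Subtype.ext (Prod.ext (Subtype.ext (funext fun l => ?_)) ?_)
  · induction l using Fin.lastCases with
    | last => exact htop
    | cast l => exact congrArg (fun r : Bichain γ m n => r.1.1.1 l) hinit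
  · exact congrArg (fun r : Bichain γ m n => r.1.2) hinit

theorem bichain_eq_of_tail_eq {n : ℕ} {p q : Bichain γ 0 (n + 1)}
    (hbot : p.1.2.1 0 = q.1.2.1 0)
    (htail : bichainTail γ n p = bichainTail γ n q) : p = q := by
  refine Subtype.ext (Prod.ext (Subtype.ext (funext fun l => ?_)) (Subtype.ext (funext fun l => ?_)))
  · obtain rfl : l = 0 := Fin.fin_one_eq_zero l
    exact p.2.trans (hbot.trans q.2.symm)
  · induction l using Fin.cases with
    | zero => exact hbot
    | succ l => exact congrArg (fun r : Bichain γ 0 n => r.1.2.1 l) htail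

/-! ### Products of `ρ_A`, `ρ_E` and `ρ_E*` with `ρ_{m,n}` -/

variable {γ} {S : Set X} (h : Admissible γ S)

theorem Admissible.word_snoc {n : ℕ} (k : Fin n → Fin N) (i : Fin N) (x : S) :
    h.word (Fin.snoc k i : Fin (n + 1) → Fin N) x = h.map i (h.word k x) :=
  Subtype.ext (orbit_snoc_last γ k i x)

theorem Admissible.word_cons {n : ℕ} (i : Fin N) (k : Fin n → Fin N) (x : S) :
    h.word (Fin.cons i k : Fin (n + 1) → Fin N) x = h.word k (h.map i x) :=
  Subtype.ext (orbit_cons_succ γ i k x (Fin.last n))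

theorem Admissible.word_of_isEmpty (k : Fin 0 → Fin N) (x : S) : h.word k x = x := rfl

variable [CompactSpace X]

theorem rho_ext {m n : ℕ} (f : C(Bichain γ m n, ℂ)) {T : Mat S}
    (h1 : ∀ (k : Fin n → Fin N) (x : S), T (e (h.word k x)) =
      ∑ j : Fin m → Fin N, f (biorbit γ j k x) • e (h.word j x))
    (h2 : ∀ y : S, (∀ (k : Fin n → Fin N) (x : S), h.word k x ≠ y) → T (e y) = 0) :
    T = rho h f :=
  (exists_rho h f).unique ⟨h1, h2⟩ (exists_rho h f).choose_spec.1

/-- `ρ_{m,n}` as a linear map `C(X_{m,n}) → M_𝕏`. -/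
def rhoLinear (m n : ℕ) : C(Bichain γ m n, ℂ) →ₗ[ℂ] Mat S where
  toFun f := rho h f
  map_add' f g := (rho_ext h _ (fun k x => by
    simp [rho_e_word, add_smul, Finset.sum_add_distrib]) fun y hy => by
    simp [rho_e_of_ne h _ y hy]).symm
  map_smul' c f := (rho_ext h _ (fun k x => by
    simp [rho_e_word, mul_smul, Finset.smul_sum]) fun y hy => by
    simp [rho_e_of_ne h _ y hy]).symm

/-- Continuity is a consequence of the closed graph theorem, each column of `ρ_{m,n}(f)` being
continuous in `f`. -/
theorem continuous_rhoLinear [T2Space X] (m n : ℕ) : Continuous (rhoLinear h m n) := by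
  refine (rhoLinear h m n).continuous_of_seq_closed_graph fun u f T hu hT => ?_
  have hcol : ∀ y : S, Filter.Tendsto (fun i => rho h (u i) (e y)) Filter.atTop (𝓝 (T (e y))) :=
    fun y => ((ContinuousLinearMap.apply ℂ (Hil S) (e y)).continuous.tendsto T).comp hT
  refine rho_ext h f (fun k x => ?_) fun y hy => ?_
  · refine tendsto_nhds_unique (hcol _) ?_
    simp only [rho_e_word]
    refine tendsto_finsetSum _ fun j _ => Filter.Tendsto.smul_const ?_ _
    exact ((continuous_eval_const (biorbit γ j k (x : X))).tendsto f).comp hu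
  · refine tendsto_nhds_unique (hcol y) ?_
    simp only [rho_e_of_ne h _ y hy]
    exact tendsto_const_nhds

theorem rhoA_mul_rho {m n : ℕ} (a : C(X, ℂ)) (f : C(Bichain γ m n, ℂ)) :
    rhoA S a * rho h f =
      rho h (⟨_, a.continuous.comp (continuous_bichain_fst γ (Fin.last m))⟩ * f) := by
  refine rho_ext h _ (fun k x => ?_) fun y hy => ?_
  · rw [mul_apply_eq_comp, rho_e_word, map_sum]
    refine Finset.sum_congr rfl fun j _ => ?_
    rw [map_smul, rhoA_e, smul_smul, mul_comm]
    rfl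
  · rw [mul_apply_eq_comp, rho_e_of_ne h _ y hy, map_zero]

/-- `ρ_E(f)` adds an entry on top of the first chain. -/
theorem rhoE_mul_rho {m n : ℕ} (f : C(Graph γ, ℂ)) (g : C(Bichain γ m n, ℂ)) :
    rhoE h f * rho h g = rho h (f.comp (topEdge γ m n) * g.comp (bichainInit γ m n)) := by
  refine rho_ext h _ (fun k x => ?_) fun y hy => ?_
  · rw [mul_apply_eq_comp, rho_e_word, map_sum,
      ← (Fin.snocEquiv fun _ : Fin (m + 1) => Fin N).sum_comp, Fintype.sum_prod_type_right]
    refine Finset.sum_congr rfl fun j _ => ?_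
    rw [map_smul, rhoE_e, Finset.smul_sum]
    refine Finset.sum_congr rfl fun i _ => ?_
    have hinit : bichainInit γ m n (biorbit γ (Fin.snoc j i : Fin (m + 1) → Fin N) k (x : X)) =
        biorbit γ j k (x : X) := Subtype.ext (Prod.ext (chainInit_orbit γ j i x) rfl)
    have htop : topEdge γ m n (biorbit γ (Fin.snoc j i : Fin (m + 1) → Fin N) k (x : X)) =
        ⟨(γ i (h.word j x), (h.word j x : X)), i, rfl⟩ :=
      Subtype.ext (Prod.ext (orbit_snoc_last γ j i x) (orbit_snoc_castSucc γ j i x _))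
    change _ = (f.comp (topEdge γ m n) * g.comp (bichainInit γ m n))
      (biorbit γ (Fin.snoc j i : Fin (m + 1) → Fin N) k (x : X)) •
        e (h.word (Fin.snoc j i : Fin (m + 1) → Fin N) x)
    rw [ContinuousMap.mul_apply, ContinuousMap.comp_apply, ContinuousMap.comp_apply, hinit, htop,
      h.word_snoc, smul_smul, mul_comm]
  · rw [mul_apply_eq_comp, rho_e_of_ne h _ y hy, map_zero]

theorem star_rhoE_e_map (f : C(Graph γ, ℂ)) (i : Fin N) (y : S) :
    star (rhoE h f) (e (h.map i y)) =
      star (f ⟨(γ i y, (y : X)), i, rfl⟩) • e y := by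
  ext z
  rw [← inner_e_left, ContinuousLinearMap.star_eq_adjoint,
    ContinuousLinearMap.adjoint_inner_right, rhoE_e, sum_inner, lp.coeFn_smul, Pi.smul_apply]
  simp only [inner_smul_left, inner_e_left]
  by_cases hz : z = y
  · subst hz
    rw [Finset.sum_eq_single i, e_apply_self, e_apply_self]
    · rfl
    · intro k _ hk
      rw [e_apply_ne fun h' => hk (h.map_inj h').1, mul_zero]
    · exact fun hi => absurd (Finset.mem_univ i) hi
  · rw [e_apply_ne hz, smul_zero]
    exact Finset.sum_eq_zero fun k _ => by
      rw [e_apply_ne fun h' => hz (h.map_inj h').2, mul_zero]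

theorem star_rhoE_e_of_ne (f : C(Graph γ, ℂ)) (x : S) (hx : ∀ i y, h.map i y ≠ x) :
    star (rhoE h f) (e x) = 0 := by
  ext z
  rw [← inner_e_left, ContinuousLinearMap.star_eq_adjoint,
    ContinuousLinearMap.adjoint_inner_right, rhoE_e, sum_inner]
  simp only [inner_smul_left, inner_e_left]
  exact Finset.sum_eq_zero fun k _ => by rw [e_apply_ne (hx k z), mul_zero]

/-- `ρ_E(f)*` removes the top entry of the first chain; the sum over the possible entries removed
is a continuous function of the remaining bichain. -/
theorem star_rhoE_mul_rho_succ {m n : ℕ} (f : C(Graph γ, ℂ)) (g : C(Bichain γ (m + 1) n, ℂ)) :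
    star (rhoE h f) * rho h g =
      rho h (∑ i, star (f.comp (nextEdge γ m n i)) * g.comp (bichainSnoc γ m n i)) := by
  refine rho_ext h _ (fun k x => ?_) fun y hy => ?_
  · rw [mul_apply_eq_comp, rho_e_word, map_sum,
      ← (Fin.snocEquiv fun _ : Fin (m + 1) => Fin N).sum_comp, Fintype.sum_prod_type_right]
    refine Finset.sum_congr rfl fun j _ => ?_
    rw [ContinuousMap.sum_apply, Finset.sum_smul]
    refine Finset.sum_congr rfl fun i _ => ?_
    have hsnoc : bichainSnoc γ m n i (biorbit γ j k (x : X)) =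
        biorbit γ (Fin.snoc j i : Fin (m + 1) → Fin N) k (x : X) :=
      Subtype.ext (Prod.ext (chainSnoc_orbit γ j i x) rfl)
    change star (rhoE h f) (g (biorbit γ (Fin.snoc j i : Fin (m + 1) → Fin N) k (x : X)) •
      e (h.word (Fin.snoc j i : Fin (m + 1) → Fin N) x)) = _
    rw [h.word_snoc, map_smul, star_rhoE_e_map, smul_smul, ContinuousMap.mul_apply,
      ContinuousMap.comp_apply, hsnoc, mul_comm]
    rfl
  · rw [mul_apply_eq_comp, rho_e_of_ne h _ y hy, map_zero]

/-- When the first chain has length `0`, `ρ_E(f)*` moves the common starting point `γ_i(y)` of the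
two chains back to `y`, which lengthens the second chain at its bottom. -/
theorem star_rhoE_mul_rho_zero {n : ℕ} (f : C(Graph γ, ℂ)) (g : C(Bichain γ 0 n, ℂ)) :
    star (rhoE h f) * rho h g =
      rho h (star (f.comp (bottomEdge γ 0 n)) * g.comp (bichainTail γ n)) := by
  refine rho_ext h _ (fun k x => ?_) fun y hy => ?_
  · obtain ⟨i, k, rfl⟩ : ∃ (i : Fin N) (k' : Fin n → Fin N),
        k = (Fin.cons i k' : Fin (n + 1) → Fin N) := ⟨k 0, Fin.tail k, (Fin.cons_self_tail k).symm⟩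
    rw [mul_apply_eq_comp, h.word_cons, rho_e_word, Fintype.sum_unique, Fintype.sum_unique,
      map_smul, h.word_of_isEmpty, h.word_of_isEmpty, star_rhoE_e_map, smul_smul, mul_comm,
      ContinuousMap.mul_apply, ContinuousMap.comp_apply]
    have hsucc : (orbit γ (Fin.cons i k : Fin (n + 1) → Fin N) (x : X)).1 1 = γ i x :=
      orbit_cons_succ γ i k x 0
    have htail : bichainTail γ n
        (biorbit γ default (Fin.cons i k : Fin (n + 1) → Fin N) (x : X)) =
        biorbit γ default k (h.map i x : X) := by
      refine Subtype.ext (Prod.ext (Subtype.ext (funext fun l => ?_)) (chainTail_orbit γ i k x))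
      obtain rfl : l = 0 := Fin.fin_one_eq_zero l
      exact hsucc
    have hbot : bottomEdge γ 0 n
        (biorbit γ default (Fin.cons i k : Fin (n + 1) → Fin N) (x : X)) =
        ⟨(γ i x, (x : X)), i, rfl⟩ := Subtype.ext (Prod.ext hsucc rfl)
    rw [htail, ContinuousMap.star_apply, ContinuousMap.comp_apply, hbot]
  · rw [mul_apply_eq_comp]
    by_cases hex : ∃ (k : Fin n → Fin N) (x : S), h.word k x = y
    · obtain ⟨k, x, rfl⟩ := hex
      rw [rho_e_word, Fintype.sum_unique, map_smul, h.word_of_isEmpty,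
        star_rhoE_e_of_ne h f x, smul_zero]
      rintro i z rfl
      exact hy _ z (h.word_cons i k z)
    · push Not at hex
      rw [rho_e_of_ne h _ y hex, map_zero]

theorem rho_zero_zero (f : C(Bichain γ 0 0, ℂ)) :
    rho h f = rhoA S (f.comp ⟨biorbit γ default default, continuous_biorbit γ _ _⟩) :=
  mat_ext fun x => by
    rw [rhoA_e]
    refine (rho_e_word h f default x).trans ?_
    rw [Fintype.sum_unique]
    rfl

/-! ### The graded pieces of `C*(ρ̂)` -/

theorem E_subset_B (m n : ℕ) {k : ℤ} (hk : (m : ℤ) - n = k) : E h m n ⊆ B h k := fun _ hT =>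
  Submodule.le_topologicalClosure _
    (Submodule.subset_span (Set.mem_iUnion₂.2 ⟨m, n, Set.mem_iUnion.2 ⟨hk, hT⟩⟩))

/-- A closed subspace contains `B_k` as soon as it contains all `E_{m,n}` with `m - n = k`. -/
theorem B_le {k : ℤ} {V : Submodule ℂ (Mat S)} (hV : IsClosed (V : Set (Mat S)))
    (hE : ∀ m n : ℕ, (m : ℤ) - n = k → ∀ f : C(Bichain γ m n, ℂ), rho h f ∈ V) : B h k ≤ V := by
  refine Submodule.topologicalClosure_minimal _ (Submodule.span_le.2 ?_) hV
  simp only [Set.iUnion_subset_iff]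
  rintro m n hk _ ⟨f, rfl⟩
  exact hE m n hk f

theorem mul_mem_B {T : Mat S} {l : ℤ}
    (hT : ∀ (m n : ℕ) (f : C(Bichain γ m n, ℂ)), T * rho h f ∈ B h (l + (m - n))) (k : ℤ) :
    ∀ b ∈ B h k, T * b ∈ B h (l + k) := by
  have hcl : IsClosed ((B h (l + k)).comap (LinearMap.mulLeft ℂ T) : Set (Mat S)) :=
    (Submodule.isClosed_topologicalClosure _).preimage (continuous_const_mul T)
  exact fun b hb => B_le h hcl (fun m n hk f => by rw [← hk]; exact hT m n f) hb

theorem tensor_mul_mem_iSup_BTensor {T : Mat S} {l : ℤ}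
    (hT : ∀ (m n : ℕ) (f : C(Bichain γ m n, ℂ)), T * rho h f ∈ B h (l + (m - n))) :
    ∀ v ∈ ⨆ k, BTensor h k, tensor T (υ l) * v ∈ ⨆ k, BTensor h k := by
  have hle : ⨆ k, BTensor h k ≤
      (⨆ k, BTensor h k).comap (LinearMap.mulLeft ℂ (tensor T (υ l))) := by
    refine iSup_le fun k => Submodule.map_le_iff_le_comap.2 fun b hb => ?_
    rw [Submodule.mem_comap, Submodule.mem_comap, LinearMap.mulLeft_apply, tensorLeft_apply,
      tensor_mul, υ_mul, ← tensorLeft_apply]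
    exact Submodule.mem_iSup_of_mem (l + k) (Submodule.mem_map_of_mem (mul_mem_B h hT k b hb))
  intro v hv
  have := hle hv
  rwa [Submodule.mem_comap, LinearMap.mulLeft_apply] at this

theorem star_rhoA (a : C(X, ℂ)) : star (rhoA S a) = rhoA S (star a) := mat_ext fun x => by
  ext z
  rw [← inner_e_left, ContinuousLinearMap.star_eq_adjoint,
    ContinuousLinearMap.adjoint_inner_right, rhoA_e, rhoA_e, inner_smul_left, inner_e_left,
    lp.coeFn_smul, Pi.smul_apply]
  by_cases hz : z = x
  · rw [hz]
    rfl
  · rw [e_apply_ne hz, mul_zero, smul_zero]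

theorem rhoHatA_mul_mem (a : C(X, ℂ)) :
    ∀ v ∈ ⨆ k, BTensor h k, rhoHatA S a * v ∈ ⨆ k, BTensor h k :=
  tensor_mul_mem_iSup_BTensor h fun m n f => by
    rw [rhoA_mul_rho]
    exact E_subset_B h m n (zero_add _).symm ⟨_, rfl⟩

theorem rhoHatE_mul_mem (f : C(Graph γ, ℂ)) :
    ∀ v ∈ ⨆ k, BTensor h k, rhoHatE h f * v ∈ ⨆ k, BTensor h k :=
  tensor_mul_mem_iSup_BTensor h fun m n g => by
    rw [rhoE_mul_rho]
    exact E_subset_B h (m + 1) n (by lia) ⟨_, rfl⟩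

theorem star_rhoHatE_mul_mem (f : C(Graph γ, ℂ)) :
    ∀ v ∈ ⨆ k, BTensor h k, star (rhoHatE h f) * v ∈ ⨆ k, BTensor h k := by
  rw [rhoHatE, star_tensor, star_υ]
  refine tensor_mul_mem_iSup_BTensor h fun m n g => ?_
  cases m with
  | zero =>
    rw [star_rhoE_mul_rho_zero]
    exact E_subset_B h 0 (n + 1) (by lia) ⟨_, rfl⟩
  | succ m =>
    rw [star_rhoE_mul_rho_succ]
    exact E_subset_B h m n (by lia) ⟨_, rfl⟩

theorem one_mem_iSup_BTensor : (1 : MatZ S) ∈ ⨆ k, BTensor h k := by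
  have h1 : rho h (1 : C(Bichain γ 0 0, ℂ)) = 1 := by
    rw [rho_zero_zero]
    exact mat_ext fun x => by
      rw [rhoA_e, one_apply_eq_self]
      exact one_smul ℂ _
  refine Submodule.mem_iSup_of_mem 0 ⟨1, E_subset_B h 0 0 (by simp) ⟨1, h1⟩, ?_⟩
  change tensor 1 (υ 0) = 1
  rw [υ_zero, tensor_one]

theorem adjoin_le_iSup_BTensor :
    (NonUnitalStarAlgebra.adjoin ℂ (Set.range (rhoHatA S) ∪ Set.range (rhoHatE h)) :
      Set (MatZ S)) ⊆ (⨆ k, BTensor h k : Submodule ℂ (MatZ S)) := by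
  have hle : NonUnitalStarAlgebra.adjoin ℂ (Set.range (rhoHatA S) ∪ Set.range (rhoHatE h)) ≤
      leftMultipliers (⨆ k, BTensor h k) := by
    refine NonUnitalStarAlgebra.adjoin_le ?_
    rintro _ (⟨a, rfl⟩ | ⟨f, rfl⟩)
    · refine ⟨rhoHatA_mul_mem h a, ?_⟩
      rw [rhoHatA, star_tensor, star_rhoA, star_υ, neg_zero]
      exact rhoHatA_mul_mem h (star a)
    · exact ⟨rhoHatE_mul_mem h f, star_rhoHatE_mul_mem h f⟩
  -- A left multiplier `T` of a subspace containing `1` lies in it, as `T = T * 1`.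
  intro T hT
  have := (hle hT).1 1 (one_mem_iSup_BTensor h)
  rwa [mul_one] at this

theorem rhoHatA_mem (a : C(X, ℂ)) : rhoHatA S a ∈ CStarRhoHat h :=
  NonUnitalStarSubalgebra.le_topologicalClosure _
    (NonUnitalStarAlgebra.subset_adjoin ℂ _ (Or.inl ⟨a, rfl⟩))

theorem rhoHatE_mem (f : C(Graph γ, ℂ)) : rhoHatE h f ∈ CStarRhoHat h :=
  NonUnitalStarSubalgebra.le_topologicalClosure _
    (NonUnitalStarAlgebra.subset_adjoin ℂ _ (Or.inr ⟨f, rfl⟩))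

/-- The subspace of all `f ∈ C(X_{m,n})` with `ρ_{m,n}(f) ⊗ υ_{m-n} ∈ C*(ρ̂)`. -/
def rhoHatPreimage (m n : ℕ) : Submodule ℂ C(Bichain γ m n, ℂ) :=
  (CStarRhoHat h).toSubmodule.comap (tensorLeft S (υ (m - n)) ∘ₗ rhoLinear h m n)

variable [T2Space X]

theorem isClosed_rhoHatPreimage (m n : ℕ) :
    IsClosed (rhoHatPreimage h m n : Set C(Bichain γ m n, ℂ)) :=
  (NonUnitalStarSubalgebra.isClosed_topologicalClosure _).preimage
    ((continuous_tensorLeft S _).comp (continuous_rhoLinear h m n))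

theorem rhoHatPreimage_zero_eq_top (n : ℕ) : rhoHatPreimage h 0 n = ⊤ := by
  induction n with
  | zero =>
    refine top_le_iff.1 fun f _ => ?_
    change tensor (rho h f) (υ 0) ∈ CStarRhoHat h
    rw [rho_zero_zero]
    exact rhoHatA_mem h _
  | succ n ih =>
    refine eq_top_of_comp_mul_comp_mem (Y := X) ⟨_, continuous_bichain_snd γ 0⟩
      (bichainTail γ n) (fun p q => bichain_eq_of_tail_eq γ) _ (isClosed_rhoHatPreimage h _ _)
      fun a g => ?_
    let f : C(Graph γ, ℂ) := ⟨fun p => star (a p.1.2), by fun_prop⟩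
    have hg : tensor (rho h g) (υ ((0 : ℕ) - n)) ∈ CStarRhoHat h :=
      (ih ▸ Submodule.mem_top : g ∈ rhoHatPreimage h 0 n)
    have hmem := mul_mem (star_mem (rhoHatE_mem h f)) hg
    rw [rhoHatE, star_tensor, star_υ, tensor_mul, υ_mul, star_rhoE_mul_rho_zero] at hmem
    change tensor (rho h _) (υ _) ∈ CStarRhoHat h
    convert hmem using 3
    · congr 1
      ext p
      simp [f, bottomEdge]
    · push_cast
      lia

theorem rhoHatPreimage_eq_top (m n : ℕ) : rhoHatPreimage h m n = ⊤ := by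
  induction m with
  | zero => exact rhoHatPreimage_zero_eq_top h n
  | succ m ih =>
    refine eq_top_of_comp_mul_comp_mem (Y := X) ⟨_, continuous_bichain_fst γ (Fin.last (m + 1))⟩
      (bichainInit γ m n) (fun p q => bichain_eq_of_init_eq γ) _ (isClosed_rhoHatPreimage h _ _)
      fun a g => ?_
    let f : C(Graph γ, ℂ) := ⟨fun p => a p.1.1, by fun_prop⟩
    have hg : tensor (rho h g) (υ (m - n)) ∈ CStarRhoHat h :=
      (ih ▸ Submodule.mem_top : g ∈ rhoHatPreimage h m n)
    have hmem := mul_mem (rhoHatE_mem h f) hg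
    rw [rhoHatE, tensor_mul, υ_mul, rhoE_mul_rho] at hmem
    change tensor (rho h _) (υ _) ∈ CStarRhoHat h
    convert hmem using 2
    congr 1
    push_cast
    lia

theorem iSup_BTensor_subset :
    ((⨆ k, BTensor h k : Submodule ℂ (MatZ S)) : Set (MatZ S)) ⊆ CStarRhoHat h := by
  have hle : ⨆ k, BTensor h k ≤ (CStarRhoHat h).toSubmodule := by
    refine iSup_le fun k => Submodule.map_le_iff_le_comap.2 (B_le h ?_ fun m n hk f => ?_)
    · exact (NonUnitalStarSubalgebra.isClosed_topologicalClosure _).preimage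
        (continuous_tensorLeft S _)
    · subst hk
      exact (rhoHatPreimage_eq_top h m n ▸ Submodule.mem_top : f ∈ rhoHatPreimage h m n)
  exact hle

end IFS

end KajiwaraWatatani

end

theorem theorem5p4p4 {X : Type*} [TopologicalSpace X] [CompactSpace X] [T2Space X] {N : ℕ}
    (γ : Fin N → C(X, X)) (S : Set X) (h : KajiwaraWatatani.Admissible γ S)
    (hemb : ∀ k, Topology.IsEmbedding (γ k)) :
    KajiwaraWatatani.IsClosedDirectSum
      (KajiwaraWatatani.CStarRhoHat h : Set (KajiwaraWatatani.MatZ S))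
      (fun k : ℤ => KajiwaraWatatani.BTensor h k) where
  isClosed k := KajiwaraWatatani.isClosed_map_tensorLeft_υ k _
    (Submodule.isClosed_topologicalClosure _)
  eq_closure := Set.Subset.antisymm (closure_mono (KajiwaraWatatani.adjoin_le_iSup_BTensor h))
    (closure_minimal (KajiwaraWatatani.iSup_BTensor_subset h)
      (NonUnitalStarSubalgebra.isClosed_topologicalClosure _))
  disjoint k := KajiwaraWatatani.disjoint_map_tensorLeft_υ (KajiwaraWatatani.B h) k
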